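/- For integers $n \ge 2$ and $1 \le k \le n-1$, let $e_1,\dots,e_n$ be the standard basis of $\mathbb{Z}_2^n$, let $\epsilon_k = e_k + e_{k+1} + \cdots + e_n$, and let the enhanced hypercube $Q_{n,k}$ be the Cayley graph $\mathrm{Cay}(\mathbb{Z}_2^n, \{e_1,\dots,e_n,\epsilon_k\})$; that is, two binary words of length $n$ are adjacent if and only if they differ in exactly one coordinate, or differ in exactly the coordinates $k, k+1, \dots, n$. For a finite connected graph $\Gamma$, let $\mathrm{Kf}(\Gamma) = \sum_{\{u,v\}} r_{uv}$ be its Kirchhoff index, where the sum runs over all unordered pairs of distinct vertices and $r_{uv}$ is the resistance distance, i.e. the effective resistance between $u$ and $v$ when every edge of $\Gamma$ is a unit resistor. Theorem. For every fixed $n \ge 2$, $\mathrm{Kf}(Q_{n,k})$ is strictly increasing in $k$ on $1 \le k \le n-1$: if $1 \le k < l \le n-1$, then $\mathrm{Kf}(Q_{n,k}) < \mathrm{Kf}(Q_{n,l})$. -/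

import Mathlib

/-! ### Resistance distance and Kirchhoff index of a finite graph -/

section Kirchhoff

open scoped Classical in
/-- Every edge of `G` is a unit resistor and `f` is an electric potential on the vertices, so by
Ohm's law the current along the edge from `x` to `y` is `f x - f y`. `f` is the potential of a
unit current from `a` to `b` if Kirchhoff's current law holds: the net current flowing out of a
vertex `x` is the external current supplied at `x`, which is `1` at `a`, `-1` at `b` and `0`
elsewhere (and is `0` everywhere if `a = b`). -/
def IsUnitCurrentPotential {V : Type*} [Fintype V] (G : SimpleGraph V) (a b : V) (f : V → ℝ) :
    Prop :=
  ∀ x : V, (∑ y : V, if G.Adj x y then f x - f y else 0) =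
    (if x = a then 1 else 0) - (if x = b then 1 else 0)

open scoped Classical in
/-- The resistance distance (effective resistance) between `a` and `b`: the potential difference
between `a` and `b` when a unit current flows from `a` to `b`. It does not depend on the chosen
potential, and a potential exists whenever `G` is connected (see the two lemmas below); the value
is `0` by convention if no unit current can flow. -/
noncomputable def resistanceDist {V : Type*} [Fintype V] (G : SimpleGraph V) (a b : V) : ℝ :=
  if h : ∃ f : V → ℝ, IsUnitCurrentPotential G a b f then h.choose a - h.choose b else 0

/-- The Kirchhoff index: the sum of the resistance distances over all unordered pairs of distinct
vertices, written as half of the sum over all ordered pairs (the diagonal contributes `0`). -/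
noncomputable def kirchhoffIndex {V : Type*} [Fintype V] (G : SimpleGraph V) : ℝ :=
  (∑ a : V, ∑ b : V, resistanceDist G a b) / 2

open scoped Classical in
theorem isUnitCurrentPotential_iff_lapMatrix {V : Type*} [Fintype V] (G : SimpleGraph V) (a b : V)
    (f : V → ℝ) :
    IsUnitCurrentPotential G a b f ↔
      (G.lapMatrix ℝ).mulVec f = Pi.single a 1 - Pi.single b 1 := by
  rw [funext_iff]
  refine forall_congr' fun x => ?_
  have h : (∑ y : V, if G.Adj x y then f x - f y else 0) = (G.lapMatrix ℝ).mulVec f x := by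
    rw [SimpleGraph.lapMatrix_mulVec_apply, SimpleGraph.neighborFinset_eq_filter,
      ← Finset.sum_filter, Finset.sum_sub_distrib, Finset.sum_const,
      ← SimpleGraph.neighborFinset_eq_filter, SimpleGraph.card_neighborFinset_eq_degree,
      nsmul_eq_mul]
  rw [h]
  simp [Pi.single_apply]

/-- The potential difference between `a` and `b` is the same for all potentials of a unit current
from `a` to `b`. -/
theorem resistanceDist_eq {V : Type*} [Fintype V] (G : SimpleGraph V) {a b : V} {f : V → ℝ}
    (hf : IsUnitCurrentPotential G a b f) : resistanceDist G a b = f a - f b := by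
  classical
  have hex : ∃ f : V → ℝ, IsUnitCurrentPotential G a b f := ⟨f, hf⟩
  have hg := hex.choose_spec
  rw [resistanceDist, dif_pos hex]
  generalize hex.choose = g at hg
  rw [isUnitCurrentPotential_iff_lapMatrix] at hf hg
  have h : g ⬝ᵥ (G.lapMatrix ℝ).mulVec f = f ⬝ᵥ (G.lapMatrix ℝ).mulVec g := by
    rw [Matrix.dotProduct_mulVec, ← Matrix.mulVec_transpose, (G.isSymm_lapMatrix ℝ).eq,
      dotProduct_comm]
  rw [hf, hg] at h
  simpa [dotProduct_sub] using h

/-- In a connected graph a unit current can flow between any two vertices. -/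
theorem exists_isUnitCurrentPotential {V : Type*} [Fintype V] {G : SimpleGraph V}
    (hG : G.Connected) (a b : V) : ∃ f : V → ℝ, IsUnitCurrentPotential G a b f := by
  classical
  let L := (G.lapMatrix ℝ).toEuclideanLin
  have hL : L.IsSymmetric :=
    Matrix.isSymmetric_toEuclideanLin_iff.2 (SimpleGraph.isHermitian_lapMatrix ℝ G)
  have hmem : (WithLp.toLp 2 (Pi.single a 1 - Pi.single b 1 : V → ℝ)) ∈ LinearMap.range L := by
    rw [← Submodule.orthogonal_orthogonal (LinearMap.range L), hL.orthogonal_range,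
      Submodule.mem_orthogonal]
    intro u hu
    have hu' : (G.lapMatrix ℝ).mulVec u.ofLp = 0 := congrArg WithLp.ofLp hu
    rw [SimpleGraph.lapMatrix_mulVec_eq_zero_iff_forall_reachable] at hu'
    have hab := hu' a b (hG.preconnected a b)
    simp [PiLp.inner_apply, sub_mul, Finset.sum_sub_distrib, hab]
  obtain ⟨f, hf⟩ := hmem
  exact ⟨f.ofLp, (isUnitCurrentPotential_iff_lapMatrix G a b _).2 (congrArg WithLp.ofLp hf)⟩

end Kirchhoff

/-! ### Enhanced hypercubes -/

section EnhancedHypercube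

/-- The vector `ε_k = e_k + e_{k+1} + ⋯ + e_n` of `(ℤ/2)^n`. Coordinates are numbered `1, …, n`
in this formula; the coordinate with number `j` is the one with index `j - 1` in `Fin n`. -/
def enhancedVector (n k : ℕ) : Fin n → ZMod 2 :=
  fun i => if k ≤ (i : ℕ) + 1 then 1 else 0

/-- The enhanced hypercube `Q_{n,k}` (`1 ≤ k ≤ n - 1`): the Cayley graph of `(ℤ/2)^n` with respect
to `S = {e_1, …, e_n, ε_k}`. -/
def enhancedHypercube (n k : ℕ) : SimpleGraph (Fin n → ZMod 2) :=
  SimpleGraph.addCayley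
    (insert (enhancedVector n k) (Set.range fun i : Fin n => (Pi.single i 1 : Fin n → ZMod 2)))

/-- Two vertices of `Q_{n,k}` are adjacent iff one arises from the other by complementing exactly
one coordinate, or by complementing exactly the coordinates `k, …, n`. -/
theorem enhancedHypercube_adj {n k : ℕ} (hk : 1 ≤ k) (hkn : k ≤ n - 1) (x y : Fin n → ZMod 2) :
    (enhancedHypercube n k).Adj x y ↔
      (∃ i : Fin n, y = Function.update x i (x i + 1)) ∨
        y = fun i : Fin n => if k ≤ (i : ℕ) + 1 then x i + 1 else x i := by
  have hneg : ∀ z : Fin n → ZMod 2, -z = z := fun z => funext fun i => ZMod.neg_eq_self_mod_two _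
  have hsub : -y + x = -x + y := by rw [hneg, hneg, add_comm]
  have h1 : ∀ i : Fin n, Function.update x i (x i + 1) = x + Pi.single i 1 := by
    intro i
    ext j
    by_cases h : j = i
    · subst h; simp
    · simp [h]
  have h2 : (fun i : Fin n => if k ≤ (i : ℕ) + 1 then x i + 1 else x i)
      = x + enhancedVector n k := by
    ext j
    by_cases h : k ≤ (j : ℕ) + 1 <;> simp [enhancedVector, h]
  have hne1 : ∀ i : Fin n, (Pi.single i 1 : Fin n → ZMod 2) ≠ 0 := by simp
  have hne2 : enhancedVector n k ≠ 0 := by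
    intro h
    have := congrFun h ⟨n - 1, by omega⟩
    have hle : k ≤ n - 1 + 1 := by omega
    simp [enhancedVector, hle] at this
  rw [enhancedHypercube, SimpleGraph.addCayley_adj, hsub, or_self, h2]
  simp only [h1, Set.mem_insert_iff, Set.mem_range, neg_add_eq_iff_eq_add]
  constructor
  · rintro ⟨-, h | ⟨i, hi⟩⟩
    · exact Or.inr h
    · exact Or.inl ⟨i, by rw [hi]; simp⟩
  · rintro (⟨i, rfl⟩ | rfl)
    · exact ⟨by simp, Or.inr ⟨i, by simp⟩⟩
    · exact ⟨by simpa using hne2, Or.inl rfl⟩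

/-- `Q_{n,k}` is connected, so that its resistance distances are actual potential differences. -/
theorem enhancedHypercube_connected (n k : ℕ) : (enhancedHypercube n k).Connected := by
  have key : ∀ (x : Fin n → ZMod 2) (s : Finset (Fin n)),
      (enhancedHypercube n k).Reachable 0 (∑ i ∈ s, Pi.single i (x i)) := by
    intro x s
    induction s using Finset.induction_on with
    | empty => simp
    | insert i s hi ih =>
      rw [Finset.sum_insert hi, add_comm]
      refine ih.trans ?_
      have h01 : ∀ z : ZMod 2, z = 0 ∨ z = 1 := by decide
      rcases h01 (x i) with h | h
      · simp [h]
      · refine SimpleGraph.Adj.reachable ?_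
        rw [enhancedHypercube, SimpleGraph.addCayley_adj, h]
        refine ⟨by simp, Or.inl (Or.inr ⟨i, by simp⟩)⟩
  have key' : ∀ x : Fin n → ZMod 2, (enhancedHypercube n k).Reachable 0 x := by
    intro x
    have h := key x Finset.univ
    rwa [Finset.univ_sum_single] at h
  exact ⟨fun x y => (key' x).symm.trans (key' y)⟩

end EnhancedHypercube

/-! ### The real characters of `(ℤ/2)^n` -/

section Characters

/-! The characters `χ_S` diagonalise the Laplacian, so the Kirchhoff index is `2 ^ n` times the sum
of the inverse nonzero eigenvalues (`kirchhoffIndex_enhancedHypercube`). With `s = |S|`, the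
eigenvalue is `2s` or `2s + 2` according to the sign `χ_S(ε_k)`, so its inverse is affine in that
sign with slope `1 / (4s(s+1))` (`inv_enhancedEigenvalue_sub`). The difference for `k < l` has terms
of both signs. Writing `1 / (s(s+1))` as `∫₀¹ t^(s-1) (1-t) dt` turns it into an integral of
differences of the generating polynomials `∑ t^|S| χ_S(ε_k) = (1+t)^(k-1) (1-t)^(n-k+1)`, which
strictly increase with `k` for `0 < t < 1` (`prod_one_add_signChar_lt`). -/

/-- The nontrivial sign character of `ℤ/2`. -/
noncomputable def signChar (z : ZMod 2) : ℝ := if z = 0 then 1 else -1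

theorem zmod_two_cases (z : ZMod 2) : z = 0 ∨ z = 1 := by
  revert z; decide

@[simp] theorem signChar_zero : signChar 0 = 1 := by simp [signChar]

@[simp] theorem signChar_one : signChar 1 = -1 := by simp [signChar]

theorem signChar_add (y z : ZMod 2) : signChar (y + z) = signChar y * signChar z := by
  have h : (1 + 1 : ZMod 2) = 0 := by decide
  rcases zmod_two_cases y with rfl | rfl <;> rcases zmod_two_cases z with rfl | rfl <;> simp [h]

variable {n : ℕ}

/-- The character `x ↦ (-1) ^ ∑ i ∈ S, x i` of `(ℤ/2)^n`. -/
noncomputable def cubeChar (S : Finset (Fin n)) (x : Fin n → ZMod 2) : ℝ :=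
  ∏ i ∈ S, signChar (x i)

theorem cubeChar_add (S : Finset (Fin n)) (x y : Fin n → ZMod 2) :
    cubeChar S (x + y) = cubeChar S x * cubeChar S y := by
  simp [cubeChar, signChar_add, Finset.prod_mul_distrib]

theorem cube_add_self (x : Fin n → ZMod 2) : x + x = 0 :=
  funext fun i => CharTwo.add_self_eq_zero (x i)

@[simp] theorem cubeChar_zero (S : Finset (Fin n)) : cubeChar S 0 = 1 := by
  simp [cubeChar]

@[simp] theorem cubeChar_empty (x : Fin n → ZMod 2) : cubeChar ∅ x = 1 := by
  simp [cubeChar]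

theorem cubeChar_mul_self (S : Finset (Fin n)) (x : Fin n → ZMod 2) :
    cubeChar S x * cubeChar S x = 1 := by
  rw [← cubeChar_add, cube_add_self, cubeChar_zero]

theorem cubeChar_eq_one_or (S : Finset (Fin n)) (x : Fin n → ZMod 2) :
    cubeChar S x = 1 ∨ cubeChar S x = -1 :=
  mul_self_eq_one_iff.1 (cubeChar_mul_self S x)

theorem cubeChar_single (S : Finset (Fin n)) (i : Fin n) :
    cubeChar S (Pi.single i 1) = if i ∈ S then -1 else 1 := by
  rw [cubeChar, ← Finset.prod_ite_eq' S i fun _ => (-1 : ℝ)]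
  refine Finset.prod_congr rfl fun j _ => ?_
  by_cases h : j = i
  · subst h; simp
  · simp [h]

/-- Used at `t = 1` for orthogonality of characters, and on `0 < t < 1` for monotonicity. -/
theorem sum_pow_card_mul_cubeChar (t : ℝ) (x : Fin n → ZMod 2) :
    ∑ S : Finset (Fin n), t ^ S.card * cubeChar S x = ∏ i, (1 + t * signChar (x i)) := by
  rw [Finset.prod_one_add, Finset.powerset_univ]
  simp [cubeChar, Finset.prod_mul_distrib]

theorem sum_cubeChar_eq_ite (x : Fin n → ZMod 2) :
    ∑ S : Finset (Fin n), cubeChar S x = if x = 0 then (2 : ℝ) ^ n else 0 := by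
  have h := sum_pow_card_mul_cubeChar 1 x
  simp only [one_pow, one_mul] at h
  rw [h]
  split_ifs with hx
  · subst hx
    simp only [Pi.zero_apply, signChar_zero, Finset.prod_const, Finset.card_univ, Fintype.card_fin]
    norm_num
  · obtain ⟨i, hi⟩ := Function.ne_iff.1 hx
    refine Finset.prod_eq_zero (Finset.mem_univ i) ?_
    rw [(zmod_two_cases (x i)).resolve_left hi]
    simp

/-- Translation by `e_i` with `i ∈ S` flips the sign of the sum. -/
theorem sum_cubeChar_eq_zero {S : Finset (Fin n)} (hS : S.Nonempty) :
    ∑ x : Fin n → ZMod 2, cubeChar S x = 0 := by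
  obtain ⟨i, hi⟩ := hS
  have h := Equiv.sum_comp (Equiv.addRight (Pi.single i 1 : Fin n → ZMod 2)) (cubeChar S)
  simp only [Equiv.coe_addRight, cubeChar_add, cubeChar_single, hi, if_true, mul_neg, mul_one,
    Finset.sum_neg_distrib] at h
  linarith

end Characters

/-! ### The Laplacian spectrum and the Kirchhoff index of `Q_{n,k}` -/

section Spectrum

variable {n k : ℕ}

/-- The Laplacian eigenvalue of `Q_{n,k}` on the character `cubeChar S`. -/
noncomputable def enhancedEigenvalue (n k : ℕ) (S : Finset (Fin n)) : ℝ :=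
  2 * S.card + (1 - cubeChar S (enhancedVector n k))

theorem enhancedEigenvalue_pos {S : Finset (Fin n)} (hS : S.Nonempty) :
    0 < enhancedEigenvalue n k S := by
  have h : (0 : ℝ) < S.card := by exact_mod_cast hS.card_pos
  rcases cubeChar_eq_one_or S (enhancedVector n k) with h1 | h1 <;>
    rw [enhancedEigenvalue, h1] <;> linarith

open scoped Classical in
theorem enhancedHypercube_sum_adj (hk : 1 ≤ k) (hkn : k ≤ n - 1) (x : Fin n → ZMod 2)
    (F : (Fin n → ZMod 2) → ℝ) :
    (∑ y, if (enhancedHypercube n k).Adj x y then F y else 0) =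
      F (x + enhancedVector n k) + ∑ i : Fin n, F (x + Pi.single i 1) := by
  -- Since `k ≤ n - 1`, the last two coordinates of `ε_k` are both `1`, so `ε_k` is no `e_i` and no
  -- neighbour is counted twice.
  have hlast : enhancedVector n k ⟨n - 1, by omega⟩ = 1 := by
    simp only [enhancedVector]; rw [if_pos (by omega)]
  have hprev : enhancedVector n k ⟨n - 2, by omega⟩ = 1 := by
    simp only [enhancedVector]; rw [if_pos (by omega)]
  have hε : enhancedVector n k ∉
      Finset.univ.image fun i : Fin n => (Pi.single i 1 : Fin n → ZMod 2) := by
    simp only [Finset.mem_image, Finset.mem_univ, true_and, not_exists]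
    intro i hi
    rw [← hi, Pi.single_apply] at hlast hprev
    have h1 : (⟨n - 1, by omega⟩ : Fin n) = i := by by_contra h; simp [h] at hlast
    have h2 : (⟨n - 2, by omega⟩ : Fin n) = i := by by_contra h; simp [h] at hprev
    have h3 := congrArg Fin.val (h1.trans h2.symm)
    simp only at h3
    omega
  have hadj : ∀ z, (enhancedHypercube n k).Adj x (x + z) ↔ z ∈ insert (enhancedVector n k)
      (Finset.univ.image fun i : Fin n => (Pi.single i 1 : Fin n → ZMod 2)) := by
    intro z
    have hneg : -z = z := funext fun i => ZMod.neg_eq_self_mod_two _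
    have h0 : z ∈ insert (enhancedVector n k)
        (Finset.univ.image fun i : Fin n => (Pi.single i 1 : Fin n → ZMod 2)) → z ≠ 0 := by
      rintro hz rfl
      simp only [Finset.mem_insert, Finset.mem_image, Finset.mem_univ, true_and] at hz
      rcases hz with hz | ⟨i, hi⟩
      · rw [← hz] at hlast; simp at hlast
      · simp at hi
    rw [enhancedHypercube, SimpleGraph.addCayley_adj]
    have hsub : -(x + z) + x = z := by rw [neg_add_rev, neg_add_cancel_right, hneg]
    rw [hsub, neg_add_cancel_left, or_self]
    simp only [Finset.mem_insert, Finset.mem_image, Finset.mem_univ, true_and, Set.mem_insert_iff,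
      Set.mem_range] at h0 ⊢
    refine ⟨fun h => h.2, fun h => ⟨?_, h⟩⟩
    simpa using h0 h
  rw [← Equiv.sum_comp (Equiv.addLeft x)]
  simp only [Equiv.coe_addLeft, hadj]
  rw [← Finset.sum_filter, Finset.filter_mem_eq_inter, Finset.univ_inter, Finset.sum_insert hε,
    Finset.sum_image]
  intro i _ j _ hij
  by_contra h
  have := congrFun hij i
  simp [h] at this

open scoped Classical in
theorem enhancedHypercube_laplacian_cubeChar (hk : 1 ≤ k) (hkn : k ≤ n - 1)
    (S : Finset (Fin n)) (x : Fin n → ZMod 2) :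
    (∑ y, if (enhancedHypercube n k).Adj x y then cubeChar S x - cubeChar S y else 0) =
      enhancedEigenvalue n k S * cubeChar S x := by
  have h : ∑ i : Fin n, (cubeChar S x - cubeChar S (x + Pi.single i 1)) =
      2 * S.card * cubeChar S x := by
    have h' : ∀ i : Fin n, cubeChar S x - cubeChar S (x + Pi.single i 1) =
        if i ∈ S then 2 * cubeChar S x else 0 := by
      intro i
      rw [cubeChar_add, cubeChar_single]
      split_ifs <;> ring
    simp only [h', Finset.sum_ite_mem, Finset.univ_inter, Finset.sum_const, nsmul_eq_mul]
    ring
  rw [enhancedHypercube_sum_adj hk hkn x fun y => cubeChar S x - cubeChar S y, h, cubeChar_add,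
    enhancedEigenvalue]
  ring

/-- The potential of a unit current from `a` to `b` in `Q_{n,k}`, expanded in characters. -/
noncomputable def enhancedPotential (n k : ℕ) (a b x : Fin n → ZMod 2) : ℝ :=
  ∑ S : Finset (Fin n) with S.Nonempty,
    (cubeChar S a - cubeChar S b) / (2 ^ n * enhancedEigenvalue n k S) * cubeChar S x

theorem isUnitCurrentPotential_enhancedPotential (hk : 1 ≤ k) (hkn : k ≤ n - 1)
    (a b : Fin n → ZMod 2) :
    IsUnitCurrentPotential (enhancedHypercube n k) a b (enhancedPotential n k a b) := by
  classical
  intro x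
  have h1 : (∑ y, if (enhancedHypercube n k).Adj x y then
      enhancedPotential n k a b x - enhancedPotential n k a b y else 0) =
      ∑ S : Finset (Fin n) with S.Nonempty,
        (cubeChar S a - cubeChar S b) / (2 ^ n * enhancedEigenvalue n k S) *
        (enhancedEigenvalue n k S * cubeChar S x) := by
    simp only [← enhancedHypercube_laplacian_cubeChar hk hkn, Finset.mul_sum]
    rw [Finset.sum_comm]
    refine Finset.sum_congr rfl fun y _ => ?_
    split_ifs
    · simp only [enhancedPotential, ← Finset.sum_sub_distrib, mul_sub]
    · simp
  have h2 : ∀ S ∈ (Finset.univ.filter fun S : Finset (Fin n) => S.Nonempty),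
      (cubeChar S a - cubeChar S b) / (2 ^ n * enhancedEigenvalue n k S) *
        (enhancedEigenvalue n k S * cubeChar S x) =
      (cubeChar S (x + a) - cubeChar S (x + b)) / 2 ^ n := by
    intro S hS
    have := (enhancedEigenvalue_pos (k := k) (Finset.mem_filter.1 hS).2).ne'
    rw [cubeChar_add, cubeChar_add]
    field_simp
  -- The empty set contributes `1 - 1 = 0`; restoring it makes orthogonality applicable.
  have h3 : ∑ S : Finset (Fin n) with S.Nonempty,
      (cubeChar S (x + a) - cubeChar S (x + b)) / 2 ^ n =
      ∑ S : Finset (Fin n), (cubeChar S (x + a) - cubeChar S (x + b)) / 2 ^ n := by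
    refine Finset.sum_filter_of_ne fun S _ hS => ?_
    rw [Finset.nonempty_iff_ne_empty]
    rintro rfl
    simp at hS
  have h4 : ∀ c, x + c = 0 ↔ x = c := fun c => by
    rw [add_eq_zero_iff_eq_neg, show -c = c from funext fun i => ZMod.neg_eq_self_mod_two _]
  refine h1.trans ?_
  rw [Finset.sum_congr rfl h2, h3, ← Finset.sum_div, Finset.sum_sub_distrib, sum_cubeChar_eq_ite,
    sum_cubeChar_eq_ite, sub_div]
  simp only [h4]
  split_ifs <;> simp

theorem kirchhoffIndex_enhancedHypercube (hk : 1 ≤ k) (hkn : k ≤ n - 1) :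
    kirchhoffIndex (enhancedHypercube n k) =
      2 ^ n * ∑ S : Finset (Fin n) with S.Nonempty, (enhancedEigenvalue n k S)⁻¹ := by
  have hr : ∀ a b, resistanceDist (enhancedHypercube n k) a b =
      ∑ S : Finset (Fin n) with S.Nonempty,
        2 / (2 ^ n * enhancedEigenvalue n k S) * (1 - cubeChar S a * cubeChar S b) := by
    intro a b
    rw [resistanceDist_eq _ (isUnitCurrentPotential_enhancedPotential hk hkn a b),
      enhancedPotential, enhancedPotential, ← Finset.sum_sub_distrib]
    refine Finset.sum_congr rfl fun S _ => ?_
    have ha := cubeChar_mul_self S a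
    have hb := cubeChar_mul_self S b
    have h : (cubeChar S a - cubeChar S b) * (cubeChar S a - cubeChar S b) =
        2 * (1 - cubeChar S a * cubeChar S b) := by linear_combination ha + hb
    rw [← mul_sub, div_mul_eq_mul_div, h, div_mul_eq_mul_div]
  -- The cross term `χ_S(a) χ_S(b)` sums to zero over `b`, leaving the `4 ^ n` ordered pairs.
  have hsum : ∀ S ∈ (Finset.univ.filter fun S : Finset (Fin n) => S.Nonempty),
      ∑ a, ∑ b, 2 / (2 ^ n * enhancedEigenvalue n k S) * (1 - cubeChar S a * cubeChar S b) =
        2 * (2 ^ n * (enhancedEigenvalue n k S)⁻¹) := by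
    intro S hS
    have hS' := (Finset.mem_filter.1 hS).2
    have := (enhancedEigenvalue_pos (k := k) hS').ne'
    simp only [← Finset.mul_sum, Finset.sum_sub_distrib, sum_cubeChar_eq_zero hS', mul_zero,
      sub_zero, Finset.sum_const, Finset.card_univ, Fintype.card_pi,
      ZMod.card, Finset.prod_const, Fintype.card_fin, nsmul_eq_mul, Nat.cast_pow, Nat.cast_ofNat,
      mul_one]
    field_simp
  rw [kirchhoffIndex]
  simp only [hr]
  rw [Finset.sum_congr rfl fun a _ => Finset.sum_comm, Finset.sum_comm, Finset.sum_congr rfl hsum,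
    ← Finset.mul_sum, ← Finset.mul_sum]
  ring

end Spectrum

/-! ### Monotonicity -/

section Monotonicity

theorem integral_pow_mul_one_sub {s : ℕ} (hs : 0 < s) :
    ∫ t in (0 : ℝ)..1, t ^ (s - 1) * (1 - t) = 1 / (s * (s + 1)) := by
  obtain ⟨m, rfl⟩ := Nat.exists_eq_succ_of_ne_zero hs.ne'
  have h : ∀ t : ℝ, t ^ (m.succ - 1) * (1 - t) = t ^ m - t ^ (m + 1) := fun t => by
    simp only [Nat.succ_eq_add_one, Nat.add_sub_cancel]; ring
  simp only [h]
  rw [intervalIntegral.integral_sub (by simp) (by simp), integral_pow, integral_pow]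
  push_cast
  have : (m : ℝ) + 1 ≠ 0 := by positivity
  have : (m : ℝ) + 1 + 1 ≠ 0 := by positivity
  field_simp
  simp

theorem inv_enhancedEigenvalue_sub {n : ℕ} (k l : ℕ) {S : Finset (Fin n)} (hS : S.Nonempty) :
    (enhancedEigenvalue n l S)⁻¹ - (enhancedEigenvalue n k S)⁻¹ =
      1 / (S.card * (S.card + 1)) *
        ((cubeChar S (enhancedVector n l) - cubeChar S (enhancedVector n k)) / 4) := by
  have h0 : (0 : ℝ) < S.card := by exact_mod_cast hS.card_pos
  rw [enhancedEigenvalue, enhancedEigenvalue]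
  generalize (S.card : ℝ) = s at h0
  have h2 : 2 * s + (1 + 1) ≠ 0 := by positivity
  rcases cubeChar_eq_one_or S (enhancedVector n k) with hk | hk <;>
    rcases cubeChar_eq_one_or S (enhancedVector n l) with hl | hl <;>
    rw [hk, hl] <;> simp only [sub_self, add_zero, sub_neg_eq_add] <;> field_simp <;> ring

/-- Replacing `ε_k` by `ε_l` with `k < l` increases the generating polynomial of the characters,
as it raises factors `1 - t` to `1 + t`. -/
theorem prod_one_add_signChar_lt {n k l : ℕ} (hk : 1 ≤ k) (hkl : k < l) (hln : l ≤ n)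
    {t : ℝ} (ht0 : 0 < t) (ht1 : t < 1) :
    ∏ i, (1 + t * signChar (enhancedVector n k i)) <
      ∏ i, (1 + t * signChar (enhancedVector n l i)) := by
  -- Strictness comes from coordinate number `k` (index `k - 1`), which `ε_k` contains and `ε_l`
  -- does not.
  refine Finset.prod_lt_prod ?_ ?_ ⟨⟨k - 1, by omega⟩, Finset.mem_univ _, ?_⟩
  · intro i _
    simp only [enhancedVector]
    split_ifs <;> simp <;> linarith
  · intro i _
    simp only [enhancedVector]
    split_ifs <;> first | omega | (simp; try linarith)
  · simp only [enhancedVector]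
    rw [if_pos (by omega), if_neg (by omega)]
    simp
    linarith

theorem sum_inv_enhancedEigenvalue_lt {n k l : ℕ} (hk : 1 ≤ k) (hkl : k < l) (hln : l ≤ n) :
    ∑ S : Finset (Fin n) with S.Nonempty, (enhancedEigenvalue n k S)⁻¹ <
      ∑ S : Finset (Fin n) with S.Nonempty, (enhancedEigenvalue n l S)⁻¹ := by
  let d : Finset (Fin n) → ℝ := fun S =>
    (cubeChar S (enhancedVector n l) - cubeChar S (enhancedVector n k)) / 4
  let g : ℝ → ℝ := fun t => ∑ S : Finset (Fin n) with S.Nonempty,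
    t ^ (S.card - 1) * (1 - t) * d S
  have hg : Continuous g := by fun_prop
  have hint : ∫ t in (0 : ℝ)..1, g t =
      ∑ S : Finset (Fin n) with S.Nonempty,
        ((enhancedEigenvalue n l S)⁻¹ - (enhancedEigenvalue n k S)⁻¹) := by
    rw [intervalIntegral.integral_finsetSum
      fun S _ => Continuous.intervalIntegrable (by fun_prop) _ _]
    refine Finset.sum_congr rfl fun S hS => ?_
    have hS' := (Finset.mem_filter.1 hS).2
    rw [intervalIntegral.integral_mul_const, integral_pow_mul_one_sub hS'.card_pos,
      inv_enhancedEigenvalue_sub k l hS']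
  have hpos : 0 < ∫ t in (0 : ℝ)..1, g t := by
    refine intervalIntegral.intervalIntegral_pos_of_pos_on (hg.intervalIntegrable _ _) ?_
      zero_lt_one
    intro t ht
    have hlt := prod_one_add_signChar_lt hk hkl hln ht.1 ht.2
    rw [← sum_pow_card_mul_cubeChar, ← sum_pow_card_mul_cubeChar, ← sub_pos,
      ← Finset.sum_sub_distrib] at hlt
    have hfilter : ∑ S : Finset (Fin n) with S.Nonempty, t ^ S.card * d S =
        ∑ S : Finset (Fin n), t ^ S.card * d S := by
      refine Finset.sum_filter_of_ne fun S _ hS => ?_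
      rw [Finset.nonempty_iff_ne_empty]
      rintro rfl
      simp [d] at hS
    -- The factor `t` raises the exponent `|S| - 1` to `|S|`, so that the generating polynomials
    -- appear.
    have htg : t * g t = (1 - t) * ∑ S : Finset (Fin n) with S.Nonempty, t ^ S.card * d S := by
      simp only [g, Finset.mul_sum]
      refine Finset.sum_congr rfl fun S hS => ?_
      have h := pow_sub_one_mul (Finset.mem_filter.1 hS).2.card_pos.ne' t
      rw [← h]
      ring
    have hd : ∑ S : Finset (Fin n), t ^ S.card * d S =
        (∑ S : Finset (Fin n), (t ^ S.card * cubeChar S (enhancedVector n l) -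
          t ^ S.card * cubeChar S (enhancedVector n k))) / 4 := by
      rw [Finset.sum_div]
      exact Finset.sum_congr rfl fun S _ => by simp only [d]; ring
    refine pos_of_mul_pos_right (a := t) ?_ ht.1.le
    rw [htg, hfilter, hd]
    exact mul_pos (sub_pos.2 ht.2) (div_pos hlt (by norm_num))
  rw [hint, Finset.sum_sub_distrib] at hpos
  exact sub_pos.1 hpos

end Monotonicity

theorem theorem5 (n : ℕ) (hn : 2 ≤ n) :
    StrictMonoOn (fun k : ℕ => kirchhoffIndex (enhancedHypercube n k)) (Set.Icc 1 (n - 1)) := by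
  intro k hk l hl hkl
  simp only [kirchhoffIndex_enhancedHypercube hk.1 hk.2, kirchhoffIndex_enhancedHypercube hl.1 hl.2]
  exact mul_lt_mul_of_pos_left
    (sum_inv_enhancedEigenvalue_lt hk.1 hkl (hl.2.trans (Nat.sub_le n 1))) (by positivity)
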